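/- **Theorem 1.1 (Comparison theorem for WLLN).** Let $(\mathbf{B},\|\cdot\|)$ be a real separable Banach space, equipped with its Borel $\sigma$-algebra. Let $\{a_n;\,n\ge 1\}$ and $\{b_n;\,n\ge 1\}$ be increasing (not necessarily strictly) sequences of positive real numbers such that $\lim_{n\to\infty}a_n=\infty$ and $\{b_n/a_n;\,n\ge 1\}$ is nondecreasing. For a sequence $\{X,X_n;\,n\ge 1\}$ of independent and identically distributed (i.i.d.) $\mathbf{B}$-valued random variables, on any probability space, write $S_n=\sum_{i=1}^n X_i$; the sequence is called symmetric if $X$ and $-X$ have the same distribution. Suppose that for every symmetric i.i.d. sequence $\{X,X_n;\,n\ge1\}$ of $\mathbf{B}$-valued random variables, $$\frac{S_n}{a_n}\to 0 \text{ in probability}\quad\text{if and only if}\quad \lim_{n\to\infty}n\,\mathbb{P}(\|X\|>a_n)=0 .$$ Then for every i.i.d. sequence $\{X,X_n;\,n\ge1\}$ of $\mathbf{B}$-valued random variables (not necessarily symmetric), with $\gamma_n=n\,\mathbb{E}\left(X I\{\|X\|\le b_n\}\right)$: 1. if $\lim_{n\to\infty}n\,\mathbb{P}(\|X\|>b_n)=0$,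 then $\dfrac{S_n-\gamma_n}{b_n}\to 0$ in probability; 2. if $\limsup_{n\to\infty}n\,\mathbb{P}(\|X\|>b_n)>0$, then $\limsup_{n\to\infty}\mathbb{P}\left(\dfrac{\|S_n-\gamma_n\|}{b_n}>\lambda\right)>0$ for every $\lambda>0$. -/

import Mathlib

open MeasureTheory ProbabilityTheory Filter
open scoped Topology ENNReal

universe u v

/-- `X 0, X 1, X 2, …` is a sequence of independent, identically distributed `B`-valued random
variables (Borel measurable maps) on the probability space `(Ω, P)`. The first term `X 0` serves
as the generic variable of the sequence. -/
structure IsIIDSeq {Ω B : Type*} [MeasurableSpace Ω] [MeasurableSpace B]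
    (P : Measure Ω) (X : ℕ → Ω → B) : Prop where
  measurable : ∀ i, Measurable (X i)
  indep : iIndepFun X P
  identDistrib : ∀ i, IdentDistrib (X i) (X 0) P P

/-- A random variable is symmetric if it has the same law as its negative. -/
def IsSymmetricRV {Ω B : Type*} [MeasurableSpace Ω] [MeasurableSpace B] [Neg B]
    (P : Measure Ω) (Y : Ω → B) : Prop :=
  IdentDistrib Y (fun ω => -Y ω) P P

/-- The sum `S_n` of the first `n` terms of the sequence. -/
def partialSum {Ω B : Type*} [AddCommMonoid B] (X : ℕ → Ω → B) (n : ℕ) (ω : Ω) : B :=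
  ∑ i ∈ Finset.range n, X i ω

/-- The centering `n 𝔼(Y 𝟙{‖Y‖ ≤ c})`. -/
noncomputable def truncatedCentering {Ω B : Type*} [MeasurableSpace Ω] [NormedAddCommGroup B]
    [NormedSpace ℝ B] (P : Measure Ω) (Y : Ω → B) (n : ℕ) (c : ℝ) : B :=
  (n : ℝ) • ∫ ω, Set.indicator {ω' | ‖Y ω'‖ ≤ c} Y ω ∂P

set_option linter.unusedSectionVars false

/-! The argument is carried out on laws: $S_n$ has law `convPow μ n`, and the hypothesis enters as
`TailImpliesWeakLaw B a`, a statement about all symmetric laws, so it may be applied to auxiliary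
ones.

The core is the transfer from `a` to `b` (`TailImpliesWeakLaw.of_monotoneOn_div`). Given a symmetric
law with tails $o(1/n)$ at $b_n$, move each $x$ radially to norm $a_N$, where $N$ is the first index
with $\|x\|\le b_N$. The image has tails $o(1/n)$ at $a_n$, hence obeys the weak law for `a`. On
$\|x\|\le b_n$, monotonicity of $b/a$ makes $(a_n/b_n)x$ a multiple of the image by an even factor
in $[0,1]$. The contraction principle therefore compares the two sums in mean. Passing from
probability to mean requires bounded summands and Hoffmann-Jørgensen's inequality
(`lintegral_enorm_convPow_le`); Markov's inequality leads back, and truncation at $b_n$ costs only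
$n\,P(\|X\|>b_n)\to0$.

For the first conclusion, symmetrize the truncated variables by differences, bound their sum in
mean, and use Jensen's inequality to replace the independent copy by the expectation
(`TailImpliesWeakLaw.tendsto_centered`).

For the second, suppose the probabilities vanish for one $\lambda$. The symmetrized sums then stay
within $2\lambda b_n$, and Lévy's inequality gives tails $o(1/n)$ at that level. The transfer
applies equally to $2\lambda b_n$, and the resulting weak law improves the level by any constant
factor, down to $b_n/2$; desymmetrizing gives tails $o(1/n)$ at $b_n$. -/

namespace WeakLaw

open Measure

/-! ### Convolution powers; the inequalities of Lévy and Hoffmann-Jørgensen -/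

section Convolution

variable {B : Type*} [NormedAddCommGroup B] [NormedSpace ℝ B] [MeasurableSpace B] [BorelSpace B]
  [SecondCountableTopology B]

/-- The law of the sum of `n` independent random variables with law `μ`. -/
noncomputable def convPow (μ : Measure B) : ℕ → Measure B
  | 0 => dirac 0
  | n + 1 => convPow μ n ∗ μ

/-- The mass that `μ` puts on vectors of norm greater than `t`. -/
noncomputable def normTail (μ : Measure B) (t : ℝ) : ℝ≥0∞ := μ {x | t < ‖x‖}

instance (μ : Measure B) [IsProbabilityMeasure μ] (n : ℕ) :
    IsProbabilityMeasure (convPow μ n) := by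
  induction n with
  | zero => exact inferInstanceAs (IsProbabilityMeasure (dirac (0 : B)))
  | succ n ih => exact inferInstanceAs (IsProbabilityMeasure (convPow μ n ∗ μ))

lemma measurableSet_norm_gt (t : ℝ) : MeasurableSet {x : B | t < ‖x‖} :=
  measurableSet_lt measurable_const measurable_norm

lemma measurableSet_norm_le (t : ℝ) : MeasurableSet {x : B | ‖x‖ ≤ t} :=
  measurableSet_le measurable_norm measurable_const

lemma compl_norm_le (t : ℝ) : {x : B | ‖x‖ ≤ t}ᶜ = {x : B | t < ‖x‖} := by
  ext; simp

lemma conv_apply (μ ν : Measure B) [SFinite ν] {A : Set B} (hA : MeasurableSet A) :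
    (μ ∗ ν) A = ∫⁻ x, ν {y | x + y ∈ A} ∂μ := by
  rw [← lintegral_indicator_one hA, lintegral_conv (measurable_one.indicator hA)]
  refine lintegral_congr fun x => ?_
  rw [← lintegral_indicator_one (by exact (measurable_const_add x) hA)]
  rfl

lemma conv_univ (μ ν : Measure B) [SFinite ν] : (μ ∗ ν) Set.univ = μ Set.univ * ν Set.univ := by
  simp [conv_apply μ ν MeasurableSet.univ, mul_comm]

lemma normTail_add (μ ν : Measure B) (t : ℝ) :
    normTail (μ + ν) t = normTail μ t + normTail ν t := rfl

lemma normTail_anti (μ : Measure B) {s t : ℝ} (h : s ≤ t) : normTail μ t ≤ normTail μ s :=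
  measure_mono fun _ hx => h.trans_lt hx

lemma normTail_conv (μ ν : Measure B) [SFinite ν] (t : ℝ) :
    normTail (μ ∗ ν) t = ∫⁻ x, ν {y | t < ‖x + y‖} ∂μ :=
  conv_apply μ ν (measurableSet_norm_gt t)

lemma isNegInvariant_iff (μ : Measure B) : μ.IsNegInvariant ↔ μ.map (fun x => -x) = μ :=
  ⟨fun h => h.neg_eq_self, fun h => ⟨h⟩⟩

lemma map_neg_conv (μ ν : Measure B) [SFinite μ] [SFinite ν] :
    (μ ∗ ν).map (fun x => -x) = μ.map (fun x => -x) ∗ ν.map (fun x => -x) :=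
  map_conv_addMonoidHom (negAddMonoidHom : B →+ B) measurable_neg

instance (μ ν : Measure B) [SFinite μ] [SFinite ν] [μ.IsNegInvariant] [ν.IsNegInvariant] :
    (μ ∗ ν).IsNegInvariant := by
  rw [isNegInvariant_iff, map_neg_conv, (isNegInvariant_iff μ).1 inferInstance,
    (isNegInvariant_iff ν).1 inferInstance]

instance : (dirac (0 : B)).IsNegInvariant := by
  rw [isNegInvariant_iff, map_dirac' measurable_neg, neg_zero]

instance (μ : Measure B) [IsProbabilityMeasure μ] [μ.IsNegInvariant] (n : ℕ) :
    (convPow μ n).IsNegInvariant := by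
  induction n with
  | zero => exact inferInstanceAs ((dirac (0 : B)).IsNegInvariant)
  | succ n ih => exact inferInstanceAs ((convPow μ n ∗ μ).IsNegInvariant)

lemma isNegInvariant_restrict (μ : Measure B) [μ.IsNegInvariant] {A : Set B}
    (hA : MeasurableSet A) (hneg : (fun x => -x) ⁻¹' A = A) :
    (μ.restrict A).IsNegInvariant := by
  rw [isNegInvariant_iff]
  conv_lhs => rw [← hneg, ← Measure.restrict_map measurable_neg hA]
  rw [(isNegInvariant_iff μ).1 inferInstance]

lemma restrict_le_add_restrict_gt (μ : Measure B) (t : ℝ) :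
    μ.restrict {x | ‖x‖ ≤ t} + μ.restrict {x | t < ‖x‖} = μ := by
  rw [← compl_norm_le]
  exact Measure.restrict_add_restrict_compl (measurableSet_norm_le t)

lemma ae_restrict_gt (μ : Measure B) (t : ℝ) : ∀ᵐ x ∂μ.restrict {x | t < ‖x‖}, t < ‖x‖ :=
  ae_restrict_mem (measurableSet_norm_gt t)

/-- Adding an independent symmetric vector to a vector of norm greater than `t` keeps the norm
greater than `t` with probability at least one half. -/
lemma mul_univ_le_two_mul_normTail_conv (e ζ : Measure B) [SFinite e] [IsFiniteMeasure ζ]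
    [ζ.IsNegInvariant] {t : ℝ} (he : ∀ᵐ x ∂e, t < ‖x‖) :
    e Set.univ * ζ Set.univ ≤ 2 * normTail (e ∗ ζ) t := by
  have key : ∀ x : B, t < ‖x‖ → ζ Set.univ ≤ 2 * ζ {y | t < ‖x + y‖} := by
    intro x hx
    have hm : MeasurableSet {y : B | t < ‖x + y‖} :=
      measurableSet_lt measurable_const (by fun_prop)
    have hneg : ζ {y | t < ‖x - y‖} = ζ {y | t < ‖x + y‖} := by
      conv_rhs => rw [← (isNegInvariant_iff ζ).1 inferInstance, map_apply measurable_neg hm]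
      simp [sub_eq_add_neg]
    -- Since $2x=(x+y)+(x-y)$, the vectors $x\pm y$ cannot both lie in the ball of radius $t$; by
    -- symmetry both events have equal mass.
    have hcover : (Set.univ : Set B) ⊆ {y | t < ‖x + y‖} ∪ {y | t < ‖x - y‖} := by
      intro y _
      by_contra hy
      simp only [Set.mem_union, Set.mem_ofPred_eq, not_or, not_lt] at hy
      have h2 : ‖(2 : ℝ) • x‖ ≤ ‖x + y‖ + ‖x - y‖ := by
        have : (2 : ℝ) • x = (x + y) + (x - y) := by rw [two_smul]; abel
        rw [this]; exact norm_add_le _ _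
      rw [norm_smul, Real.norm_two] at h2
      linarith [hy.1, hy.2]
    calc ζ Set.univ ≤ _ := measure_mono hcover
      _ ≤ _ := measure_union_le _ _
      _ = _ := by rw [hneg, two_mul]
  calc e Set.univ * ζ Set.univ = ∫⁻ _, ζ Set.univ ∂e := by simp [mul_comm]
    _ ≤ ∫⁻ x, 2 * ζ {y | t < ‖x + y‖} ∂e := lintegral_mono_ae (he.mono key)
    _ = _ := by rw [lintegral_const_mul' _ _ (by simp), normTail_conv]

lemma convPow_add (μ : Measure B) [IsProbabilityMeasure μ] (m n : ℕ) :
    convPow μ (m + n) = convPow μ m ∗ convPow μ n := by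
  induction n with
  | zero => exact (conv_dirac_zero _).symm
  | succ n ih =>
    change convPow μ (m + n) ∗ μ = convPow μ m ∗ (convPow μ n ∗ μ)
    rw [ih, conv_assoc]

/-- A weak form of Lévy's inequality for partial sums. -/
lemma normTail_convPow_le (μ : Measure B) [IsProbabilityMeasure μ] [μ.IsNegInvariant] (t : ℝ)
    {m n : ℕ} (h : m ≤ n) : normTail (convPow μ m) t ≤ 2 * normTail (convPow μ n) t := by
  obtain ⟨k, rfl⟩ := Nat.exists_eq_add_of_le h
  have h1 := mul_univ_le_two_mul_normTail_conv _ (convPow μ k) (ae_restrict_gt (convPow μ m) t)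
  rw [measure_univ (μ := convPow μ k), mul_one, Measure.restrict_apply_univ] at h1
  refine h1.trans ?_
  conv_rhs => rw [convPow_add, ← restrict_le_add_restrict_gt (convPow μ m) t, add_conv,
    normTail_add]
  gcongr
  exact le_add_self

/-- Lévy's inequality for the largest summand, with an additional symmetric summand `η`. -/
lemma univ_le_two_mul_normTail_convPow_conv (μ : Measure B) [IsProbabilityMeasure μ]
    [μ.IsNegInvariant] (t : ℝ) (n : ℕ) :
    ∀ (η : Measure B) [IsFiniteMeasure η] [η.IsNegInvariant],
      η Set.univ ≤ 2 * normTail (convPow μ n ∗ η) t + μ {x | ‖x‖ ≤ t} ^ n * η Set.univ := by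
  induction n with
  | zero => intro η _ _; simp
  | succ n ih =>
    intro η _ _
    set μ₁ := μ.restrict {x | ‖x‖ ≤ t} with hμ₁
    set μ₂ := μ.restrict {x | t < ‖x‖} with hμ₂
    have hsplit : μ₁ + μ₂ = μ := restrict_le_add_restrict_gt μ t
    have : μ₁.IsNegInvariant :=
      isNegInvariant_restrict μ (measurableSet_norm_le t) (by ext; simp)
    have : μ₂.IsNegInvariant :=
      isNegInvariant_restrict μ (measurableSet_norm_gt t) (by ext; simp)
    -- Split by the size of one summand: a small one is absorbed into `η`, which is why `η` is
    -- general in the induction, and a large one is handled by reflection.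
    have e1 : convPow μ (n + 1) ∗ η = convPow μ n ∗ (μ₁ ∗ η) + μ₂ ∗ (convPow μ n ∗ η) := by
      calc convPow μ (n + 1) ∗ η = (convPow μ n ∗ (μ₁ + μ₂)) ∗ η := by rw [hsplit]; rfl
        _ = _ := by
          rw [conv_add, add_conv, conv_assoc, conv_comm (convPow μ n) μ₂, conv_assoc]
    have hA := ih (μ₁ ∗ η)
    have hB := mul_univ_le_two_mul_normTail_conv μ₂ (convPow μ n ∗ η) (ae_restrict_gt μ t)
    rw [conv_univ] at hA hB
    rw [measure_univ (μ := convPow μ n), one_mul] at hB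
    have hμ₁u : μ₁ Set.univ = μ {x | ‖x‖ ≤ t} := Measure.restrict_apply_univ _
    have hu : η Set.univ = μ₁ Set.univ * η Set.univ + μ₂ Set.univ * η Set.univ := by
      rw [← add_mul, ← Measure.add_apply, hsplit, measure_univ (μ := μ), one_mul]
    calc η Set.univ = _ := hu
      _ ≤ _ := add_le_add hA hB
      _ = _ := by rw [e1, normTail_add, hμ₁u]; ring

lemma one_le_two_mul_normTail_convPow (μ : Measure B) [IsProbabilityMeasure μ]
    [μ.IsNegInvariant] (t : ℝ) (n : ℕ) :
    1 ≤ 2 * normTail (convPow μ n) t + μ {x | ‖x‖ ≤ t} ^ n := by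
  simpa using univ_le_two_mul_normTail_convPow_conv μ t n (dirac 0)

/-- The bound on the number of large summands that follows from Lévy's inequality. -/
lemma mul_normTail_le_four_mul (μ : Measure B) [IsProbabilityMeasure μ] [μ.IsNegInvariant]
    (t : ℝ) (n : ℕ) (h : normTail (convPow μ n) t ≤ 4⁻¹) :
    n * normTail μ t ≤ 4 * normTail (convPow μ n) t := by
  have h1 := one_le_two_mul_normTail_convPow μ t n
  have h2 : μ {x | ‖x‖ ≤ t} + normTail μ t = 1 := by
    rw [normTail, ← compl_norm_le, measure_add_measure_compl (measurableSet_norm_le t),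
      measure_univ]
  have hp : normTail μ t ≠ ∞ := measure_ne_top _ _
  have hq : μ {x | ‖x‖ ≤ t} ≠ ∞ := measure_ne_top _ _
  have hT : normTail (convPow μ n) t ≠ ∞ := measure_ne_top _ _
  generalize normTail (convPow μ n) t = T at *
  generalize normTail μ t = p at *
  generalize μ {x | ‖x‖ ≤ t} = q at *
  lift p to NNReal using hp
  lift q to NNReal using hq
  lift T to NNReal using hT
  have h4 : (4⁻¹ : ℝ≥0∞) = ((4⁻¹ : NNReal) : ℝ≥0∞) := by norm_num
  rw [h4] at h
  norm_cast at h h1 h2 ⊢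
  rw [← NNReal.coe_le_coe] at h h1 ⊢
  rw [← NNReal.coe_inj] at h2
  push_cast at h h1 h2 ⊢
  have hp0 : (0 : ℝ) ≤ p := p.2
  have hq0 : (0 : ℝ) ≤ q := q.2
  have hT0 : (0 : ℝ) ≤ T := T.2
  generalize (p : ℝ) = p at *
  generalize (q : ℝ) = q at *
  generalize (T : ℝ) = T at *
  -- As $q(1+p)=1-p^2\le1$, Bernoulli gives $q^n\le 1/(1+np)$. Then $np\le 2T(1+np)$, and $T\le 1/4$
  -- absorbs the term $2T\,np\le np/2$.
  have hb : 1 + n * p ≤ (1 + p) ^ n := one_add_mul_le_pow (by linarith) n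
  have hq1 : q ^ n * (1 + n * p) ≤ 1 := by
    calc q ^ n * (1 + n * p) ≤ q ^ n * (1 + p) ^ n := by gcongr
      _ = (q * (1 + p)) ^ n := (mul_pow _ _ _).symm
      _ ≤ 1 := pow_le_one₀ (by positivity) (by nlinarith)
  have hnp : 0 ≤ n * p := by positivity
  have h3 : (1 + n * p) ≤ (1 + n * p) * (2 * T) + 1 := by nlinarith
  nlinarith

/-- Hoffmann-Jørgensen's inequality, started from a finite measure `κ` on the ball of radius `t`. -/
lemma exists_normTail_conv_convPow_le (μ : Measure B) [IsProbabilityMeasure μ]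
    [μ.IsNegInvariant] {s t : ℝ} (hs : 0 ≤ s) (ht : 0 ≤ t) (hμ : ∀ᵐ x ∂μ, ‖x‖ ≤ s) (M : ℝ≥0∞)
    (n : ℕ) (hM : ∀ m ≤ n, normTail (convPow μ m) t ≤ M) :
    ∀ (κ : Measure B) [IsFiniteMeasure κ], (∀ᵐ x ∂κ, ‖x‖ ≤ t) →
      ∃ E : ℝ≥0∞, normTail (κ ∗ convPow μ n) (2 * t + s) ≤ E * M ∧
        E ≤ 2 * normTail (κ ∗ convPow μ n) t := by
  induction n with
  | zero =>
    intro κ _ hκ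
    refine ⟨0, ?_, zero_le⟩
    have : normTail κ (2 * t + s) = 0 := by
      rw [normTail, measure_eq_zero_iff_ae_notMem]
      filter_upwards [hκ] with x hx hx'
      change 2 * t + s < ‖x‖ at hx'
      linarith
    rw [convPow, conv_dirac_zero, this, zero_mul]
  | succ n ih =>
    intro κ _ hκ
    -- First-exit decomposition: `κ₁` is still inside the ball, `κ₂` leaves it at this step. `E`
    -- accumulates the mass of all exits.
    set κ₁ := (κ ∗ μ).restrict {x | ‖x‖ ≤ t} with hκ₁
    set κ₂ := (κ ∗ μ).restrict {x | t < ‖x‖} with hκ₂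
    have hsplit : κ₁ + κ₂ = κ ∗ μ := restrict_le_add_restrict_gt _ t
    obtain ⟨E, hE1, hE2⟩ := ih (fun m hm => hM m (by lia)) κ₁
      (ae_restrict_mem (measurableSet_norm_le t))
    have e1 : κ ∗ convPow μ (n + 1) = κ₁ ∗ convPow μ n + κ₂ ∗ convPow μ n := by
      rw [← add_conv, hsplit, conv_assoc, conv_comm μ]; rfl
    have hbound : ∀ᵐ x ∂κ ∗ μ, ‖x‖ ≤ t + s := by
      rw [ae_iff]
      simp only [not_le]
      rw [conv_apply _ _ (measurableSet_norm_gt _)]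
      refine (lintegral_congr_ae ?_).trans lintegral_zero
      filter_upwards [hκ] with x hx
      rw [measure_eq_zero_iff_ae_notMem]
      filter_upwards [hμ] with y hy hy'
      change t + s < ‖x + y‖ at hy'
      linarith [norm_add_le x y]
    have hκ₂b : ∀ᵐ x ∂κ₂, ‖x‖ ≤ t + s := ae_restrict_of_ae hbound
    -- The exiting mass overshoots by at most `s`, so ending beyond `2 * t + s` forces the remaining
    -- sum beyond `t`, which costs a factor `M`. By reflection, at least half of the exiting mass
    -- also ends beyond `t`.
    refine ⟨E + κ₂ Set.univ, ?_, ?_⟩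
    · rw [e1, normTail_add, add_mul]
      refine add_le_add hE1 ?_
      rw [normTail_conv]
      calc ∫⁻ x, convPow μ n {y | 2 * t + s < ‖x + y‖} ∂κ₂ ≤ ∫⁻ _, M ∂κ₂ := by
            refine lintegral_mono_ae (hκ₂b.mono fun x hx => ?_)
            refine le_trans (measure_mono fun y hy => ?_) (hM n (by lia))
            simp only [Set.mem_ofPred_eq] at hy ⊢
            linarith [norm_add_le x y]
        _ = κ₂ Set.univ * M := by simp [mul_comm]
    · rw [e1, normTail_add, mul_add]
      refine add_le_add hE2 ?_
      have := mul_univ_le_two_mul_normTail_conv κ₂ (convPow μ n) (ae_restrict_gt _ t)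
      rwa [measure_univ (μ := convPow μ n), mul_one] at this

/-- Hoffmann-Jørgensen's inequality for bounded symmetric summands. -/
lemma normTail_convPow_two_mul_add_le (μ : Measure B) [IsProbabilityMeasure μ]
    [μ.IsNegInvariant] {s t : ℝ} (hs : 0 ≤ s) (ht : 0 ≤ t) (hμ : ∀ᵐ x ∂μ, ‖x‖ ≤ s) (n : ℕ) :
    normTail (convPow μ n) (2 * t + s) ≤ 4 * normTail (convPow μ n) t ^ 2 := by
  obtain ⟨E, hE1, hE2⟩ := exists_normTail_conv_convPow_le μ hs ht hμ _ n
    (fun m hm => normTail_convPow_le μ t hm) (dirac 0) (by rw [ae_dirac_eq]; simpa using ht)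
  rw [dirac_zero_conv] at hE1 hE2
  calc _ ≤ _ := hE1
    _ ≤ 2 * normTail (convPow μ n) t * (2 * normTail (convPow μ n) t) := by gcongr
    _ = _ := by ring

/-- The bound that results from iterating Hoffmann-Jørgensen's inequality. -/
lemma four_mul_normTail_convPow_le (μ : Measure B) [IsProbabilityMeasure μ]
    [μ.IsNegInvariant] {s : ℝ} (hs : 0 ≤ s) (hμ : ∀ᵐ x ∂μ, ‖x‖ ≤ s) (n : ℕ)
    (h1 : 4 * normTail (convPow μ n) s ≤ 1) (k : ℕ) :
    4 * normTail (convPow μ n) (3 ^ k * s) ≤ (4 * normTail (convPow μ n) s) ^ (k + 1) := by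
  induction k with
  | zero => simp
  | succ k ih =>
    have h3 : (1 : ℝ) ≤ 3 ^ k := one_le_pow₀ (by norm_num)
    calc 4 * normTail (convPow μ n) (3 ^ (k + 1) * s)
        ≤ 4 * normTail (convPow μ n) (2 * (3 ^ k * s) + s) := by
          gcongr
          refine normTail_anti _ ?_
          rw [pow_succ]; nlinarith
      _ ≤ 4 * (4 * normTail (convPow μ n) (3 ^ k * s) ^ 2) := by
          gcongr
          exact normTail_convPow_two_mul_add_le μ hs (by positivity) hμ n
      _ = (4 * normTail (convPow μ n) (3 ^ k * s)) ^ 2 := by ring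
      _ ≤ ((4 * normTail (convPow μ n) s) ^ (k + 1)) ^ 2 := by gcongr
      _ = (4 * normTail (convPow μ n) s) ^ (k + 2 + k) := by rw [← pow_mul]; ring_nf
      -- Squaring doubles the exponent; linear growth is enough for a geometric series later.
      _ ≤ _ := pow_le_pow_right_of_le_one' h1 (by lia)

end Convolution

/-! ### From probability to mean; contraction; the cost of truncation -/

section MeanBounds

variable {B : Type*} [NormedAddCommGroup B] [NormedSpace ℝ B] [MeasurableSpace B] [BorelSpace B]
  [SecondCountableTopology B]

/-- Cut the range of the norm at $\delta s$, $s$, $3s$, $9s,\dots$ and bound it on each shell by the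
outer radius. The ratio 3 is that of the iterated Hoffmann-Jørgensen bound. -/
lemma enorm_le_tsum_indicator {s δ : ℝ} (hs : 0 < s) (x : B) :
    ‖x‖ₑ ≤ ENNReal.ofReal (δ * s) +
      ({x : B | δ * s < ‖x‖}.indicator (fun _ => ENNReal.ofReal s) x +
      ∑' k : ℕ, {x : B | 3 ^ k * s < ‖x‖}.indicator
        (fun _ => 3 ^ (k + 1) * ENNReal.ofReal s) x) := by
  rw [← ofReal_norm]
  rcases le_or_gt ‖x‖ (δ * s) with h1 | h1
  · exact (ENNReal.ofReal_le_ofReal h1).trans le_self_add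
  refine le_add_of_le_right ?_
  rcases le_or_gt ‖x‖ s with h2 | h2
  · refine le_add_of_le_left ?_
    rw [Set.indicator_of_mem (by exact h1)]
    exact ENNReal.ofReal_le_ofReal h2
  refine le_add_of_le_right ?_
  have hex : ∃ k : ℕ, ‖x‖ ≤ 3 ^ k * s := by
    obtain ⟨k, hk⟩ := pow_unbounded_of_one_lt (‖x‖ / s) (by norm_num : (1 : ℝ) < 3)
    exact ⟨k, by rw [div_lt_iff₀ hs] at hk; exact hk.le⟩
  classical
  have hpos : Nat.find hex ≠ 0 := by
    intro h0
    have := Nat.find_spec hex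
    rw [h0, pow_zero, one_mul] at this
    linarith
  obtain ⟨k, hk⟩ := Nat.exists_eq_succ_of_ne_zero hpos
  have hlow : 3 ^ k * s < ‖x‖ := not_le.1 (Nat.find_min hex (by lia))
  have hup : ‖x‖ ≤ 3 ^ (k + 1) * s := by simpa [hk] using Nat.find_spec hex
  refine le_trans ?_ (ENNReal.le_tsum k)
  rw [Set.indicator_of_mem (by exact hlow)]
  refine (ENNReal.ofReal_le_ofReal hup).trans_eq ?_
  rw [ENNReal.ofReal_mul (by positivity), ENNReal.ofReal_pow (by norm_num)]
  norm_num

/-- For bounded symmetric summands, smallness in probability gives smallness in mean. -/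
lemma lintegral_enorm_convPow_le (μ : Measure B) [IsProbabilityMeasure μ] [μ.IsNegInvariant]
    {s : ℝ} (δ : ℝ) (hs : 0 < s) (hμ : ∀ᵐ x ∂μ, ‖x‖ ≤ s) (n : ℕ)
    (h : 24 * normTail (convPow μ n) s ≤ 1) :
    ∫⁻ x, ‖x‖ₑ ∂convPow μ n ≤ ENNReal.ofReal (δ * s) +
      (normTail (convPow μ n) (δ * s) + 24 * normTail (convPow μ n) s) * ENNReal.ofReal s := by
  set p := normTail (convPow μ n) s with hp
  have h12 : 12 * p ≤ 2⁻¹ := by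
    rw [ENNReal.le_inv_iff_mul_le]
    calc 12 * p * 2 = 24 * p := by ring
      _ ≤ 1 := h
  have h4 : 4 * p ≤ 1 := le_trans (by gcongr; norm_num) h
  -- The ratio $12p$ is 3 from the shell radii times $4p$ from the iterated tail bound; $24p\le1$
  -- keeps it at most one half.
  have hgeom : ∑' k : ℕ, (12 * p) ^ (k + 1) ≤ 24 * p := by
    have hinv : (1 - 12 * p)⁻¹ ≤ 2 := by
      rw [ENNReal.inv_le_iff_inv_le]
      refine ENNReal.le_sub_of_add_le_right (ne_top_of_le_ne_top (by simp) h12) ?_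
      calc 2⁻¹ + 12 * p ≤ 2⁻¹ + 2⁻¹ := by gcongr
        _ = 1 := ENNReal.inv_two_add_inv_two
    calc ∑' k : ℕ, (12 * p) ^ (k + 1) = ∑' k : ℕ, 12 * p * (12 * p) ^ k := by
          simp_rw [pow_succ']
      _ = 12 * p * (1 - 12 * p)⁻¹ := by rw [ENNReal.tsum_mul_left, ENNReal.tsum_geometric]
      _ ≤ 12 * p * 2 := by gcongr
      _ = 24 * p := by ring
  calc ∫⁻ x, ‖x‖ₑ ∂convPow μ n ≤ _ :=
        lintegral_mono fun x => enorm_le_tsum_indicator (δ := δ) hs x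
    _ = ENNReal.ofReal (δ * s) + (ENNReal.ofReal s * normTail (convPow μ n) (δ * s) +
        ∑' k : ℕ, 3 ^ (k + 1) * ENNReal.ofReal s * normTail (convPow μ n) (3 ^ k * s)) := by
      rw [lintegral_add_left measurable_const, lintegral_add_left
        (measurable_const.indicator (measurableSet_norm_gt _)), lintegral_tsum fun k =>
        (measurable_const.indicator (measurableSet_norm_gt _)).aemeasurable]
      simp_rw [lintegral_indicator_const (measurableSet_norm_gt _)]
      simp [normTail]
    _ ≤ ENNReal.ofReal (δ * s) + (ENNReal.ofReal s * normTail (convPow μ n) (δ * s) +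
        ∑' k : ℕ, ENNReal.ofReal s * (12 * p) ^ (k + 1)) := by
      refine add_le_add_right (add_le_add_right (ENNReal.tsum_le_tsum fun k => ?_) _) _
      have h5 : normTail (convPow μ n) (3 ^ k * s) ≤ (4 * p) ^ (k + 1) :=
        le_trans (le_mul_of_one_le_left zero_le (by norm_num))
          (four_mul_normTail_convPow_le μ hs.le hμ n h4 k)
      calc 3 ^ (k + 1) * ENNReal.ofReal s * normTail (convPow μ n) (3 ^ k * s)
          ≤ 3 ^ (k + 1) * ENNReal.ofReal s * (4 * p) ^ (k + 1) := by gcongr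
        _ = ENNReal.ofReal s * (3 * (4 * p)) ^ (k + 1) := by rw [mul_pow 3]; ring
        _ = _ := by rw [← mul_assoc]; norm_num
    _ ≤ ENNReal.ofReal (δ * s) + (ENNReal.ofReal s * normTail (convPow μ n) (δ * s) +
        ENNReal.ofReal s * (24 * p)) := by
      rw [ENNReal.tsum_mul_left]; gcongr
    _ = _ := by ring

lemma eventually_lintegral_enorm_convPow_le (μ : ℕ → Measure B)
    [∀ n, IsProbabilityMeasure (μ n)] [∀ n, (μ n).IsNegInvariant] {s : ℕ → ℝ}
    (hs : ∀ᶠ n in atTop, 0 < s n) (hμ : ∀ᶠ n in atTop, ∀ᵐ x ∂μ n, ‖x‖ ≤ s n)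
    (hT : ∀ ε : ℝ, 0 < ε →
      Tendsto (fun n => normTail (convPow (μ n) n) (ε * s n)) atTop (𝓝 0))
    {ε : ℝ} (hε : 0 < ε) :
    ∀ᶠ n in atTop, ∫⁻ x, ‖x‖ₑ ∂convPow (μ n) n ≤ ENNReal.ofReal (ε * s n) := by
  have h1 : Tendsto (fun n => 24 * normTail (convPow (μ n) n) (s n)) atTop (𝓝 0) := by
    simpa using ENNReal.Tendsto.const_mul (hT 1 one_pos) (Or.inr (by simp : (24 : ℝ≥0∞) ≠ ∞))
  have h2 := (hT (ε / 2) (half_pos hε)).add h1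
  rw [add_zero] at h2
  filter_upwards [hs, hμ, h1.eventually_le_const (zero_lt_one),
    h2.eventually_le_const (ENNReal.ofReal_pos.2 (half_pos hε))] with n hsn hμn h1n h2n
  refine (lintegral_enorm_convPow_le (μ n) (ε / 2) hsn hμn n h1n).trans ?_
  calc _ ≤ ENNReal.ofReal (ε / 2 * s n) + ENNReal.ofReal (ε / 2) * ENNReal.ofReal (s n) := by
        gcongr
    _ = ENNReal.ofReal (ε * s n) := by
        rw [← ENNReal.ofReal_mul (by positivity), ← ENNReal.ofReal_add (by positivity)
          (by positivity)]
        ring_nf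

lemma tendsto_normTail_of_lintegral_enorm_le {ρ : ℕ → Measure B} {s : ℕ → ℝ}
    (hs : ∀ᶠ n in atTop, 0 < s n)
    (h : ∀ ε : ℝ, 0 < ε → ∀ᶠ n in atTop, ∫⁻ x, ‖x‖ₑ ∂ρ n ≤ ENNReal.ofReal (ε * s n))
    {ε : ℝ} (hε : 0 < ε) : Tendsto (fun n => normTail (ρ n) (ε * s n)) atTop (𝓝 0) := by
  rw [ENNReal.tendsto_nhds_zero]
  intro η hη
  obtain ⟨r, hr0, hr⟩ : ∃ r : ℝ, 0 < r ∧ ENNReal.ofReal r ≤ η := by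
    rcases eq_or_ne η ∞ with rfl | hηt
    · exact ⟨1, one_pos, le_top⟩
    · exact ⟨η.toReal, ENNReal.toReal_pos hη.ne' hηt, ENNReal.ofReal_toReal_le⟩
  filter_upwards [hs, h (r * ε) (by positivity)] with n hsn hn
  have hpos : 0 < ε * s n := by positivity
  have hsub : {x : B | ε * s n < ‖x‖} ⊆ {x | ENNReal.ofReal (ε * s n) ≤ ‖x‖ₑ} := by
    intro x hx
    change ENNReal.ofReal (ε * s n) ≤ ‖x‖ₑ
    rw [← ofReal_norm]
    exact ENNReal.ofReal_le_ofReal (le_of_lt hx)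
  calc normTail (ρ n) (ε * s n) ≤ _ := measure_mono hsub
    _ ≤ (∫⁻ x, ‖x‖ₑ ∂ρ n) / ENNReal.ofReal (ε * s n) :=
      meas_ge_le_lintegral_div (by fun_prop) (by simpa using hpos) (by simp)
    _ ≤ ENNReal.ofReal (r * ε * s n) / ENNReal.ofReal (ε * s n) := by gcongr
    _ = ENNReal.ofReal r := by
      rw [← ENNReal.ofReal_div_of_pos hpos]; congr 1; field_simp
    _ ≤ η := hr

/-- The contraction principle for one symmetric summand. -/
lemma lintegral_enorm_add_le (μ : Measure B) [μ.IsNegInvariant] {f g : B → B} {c : B → ℝ}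
    (hg : Measurable g) (hc : Measurable c) (hc0 : ∀ x, 0 ≤ c x) (hc1 : ∀ x, c x ≤ 1)
    (hceven : ∀ x, c (-x) = c x) (hgodd : ∀ x, g (-x) = -g x) (hfg : ∀ x, f x = c x • g x)
    (z : B) : ∫⁻ x, ‖z + f x‖ₑ ∂μ ≤ ∫⁻ x, ‖z + g x‖ₑ ∂μ := by
  -- $z+cg$ is the convex combination of $z\pm g$ with weights $(1\pm c)/2$. Reflecting $x$ then
  -- turns $z-g$ into $z+g$ under the integral, and the weights add up to 1.
  have hpt : ∀ x, ‖z + f x‖ₑ ≤ ENNReal.ofReal ((1 + c x) / 2) * ‖z + g x‖ₑ +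
      ENNReal.ofReal ((1 - c x) / 2) * ‖z - g x‖ₑ := by
    intro x
    have h1 := hc0 x
    have h2 := hc1 x
    rw [← ofReal_norm, ← ofReal_norm, ← ofReal_norm, ← ENNReal.ofReal_mul (by linarith),
      ← ENNReal.ofReal_mul (by linarith), ← ENNReal.ofReal_add
      (mul_nonneg (by linarith) (norm_nonneg _)) (mul_nonneg (by linarith) (norm_nonneg _))]
    refine ENNReal.ofReal_le_ofReal ?_
    have : z + f x = ((1 + c x) / 2) • (z + g x) + ((1 - c x) / 2) • (z - g x) := by
      rw [hfg]; module
    rw [this]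
    refine (norm_add_le _ _).trans_eq ?_
    rw [norm_smul, norm_smul, Real.norm_of_nonneg (by linarith), Real.norm_of_nonneg (by linarith)]
  have hswap : ∫⁻ x, ENNReal.ofReal ((1 - c x) / 2) * ‖z - g x‖ₑ ∂μ =
      ∫⁻ x, ENNReal.ofReal ((1 - c x) / 2) * ‖z + g x‖ₑ ∂μ := by
    conv_lhs => rw [← (isNegInvariant_iff μ).1 inferInstance]
    rw [lintegral_map (by fun_prop) measurable_neg]
    simp [hceven, hgodd]
  calc ∫⁻ x, ‖z + f x‖ₑ ∂μ ≤ _ := lintegral_mono hpt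
    _ = ∫⁻ x, (ENNReal.ofReal ((1 + c x) / 2) * ‖z + g x‖ₑ +
        ENNReal.ofReal ((1 - c x) / 2) * ‖z + g x‖ₑ) ∂μ := by
      rw [lintegral_add_left (by fun_prop), hswap, lintegral_add_left (by fun_prop)]
    _ = _ := by
      refine lintegral_congr fun x => ?_
      have h1 := hc0 x
      have h2 := hc1 x
      rw [← add_mul, ← ENNReal.ofReal_add (by linarith) (by linarith)]
      ring_nf
      simp

/-- Replace the summands one at a time, conditioning on all others; the shift `z` carries the part
held fixed. -/
lemma lintegral_convPow_mono {μ ν : Measure B} [IsProbabilityMeasure μ] [IsProbabilityMeasure ν]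
    (h : ∀ z : B, ∫⁻ x, ‖z + x‖ₑ ∂μ ≤ ∫⁻ x, ‖z + x‖ₑ ∂ν) (n : ℕ) (z : B) :
    ∫⁻ x, ‖z + x‖ₑ ∂convPow μ n ≤ ∫⁻ x, ‖z + x‖ₑ ∂convPow ν n := by
  induction n generalizing z with
  | zero => exact le_rfl
  | succ n ih =>
    calc ∫⁻ x, ‖z + x‖ₑ ∂convPow μ (n + 1)
        = ∫⁻ x, ∫⁻ y, ‖z + (x + y)‖ₑ ∂μ ∂convPow μ n :=
          lintegral_conv (f := fun x => ‖z + x‖ₑ) (by fun_prop)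
      _ ≤ ∫⁻ x, ∫⁻ y, ‖z + (x + y)‖ₑ ∂ν ∂convPow μ n := by
        refine lintegral_mono fun x => ?_
        simpa [add_assoc] using h (z + x)
      _ = ∫⁻ x, ‖z + x‖ₑ ∂(ν ∗ convPow μ n) := by
        rw [conv_comm]
        exact (lintegral_conv (f := fun x => ‖z + x‖ₑ) (by fun_prop)).symm
      _ = ∫⁻ x, ∫⁻ y, ‖z + (x + y)‖ₑ ∂convPow μ n ∂ν :=
        lintegral_conv (f := fun x => ‖z + x‖ₑ) (by fun_prop)
      _ ≤ ∫⁻ x, ∫⁻ y, ‖z + (x + y)‖ₑ ∂convPow ν n ∂ν := by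
        refine lintegral_mono fun x => ?_
        simpa [add_assoc] using ih (z + x)
      _ = ∫⁻ x, ‖z + x‖ₑ ∂(ν ∗ convPow ν n) :=
        (lintegral_conv (f := fun x => ‖z + x‖ₑ) (by fun_prop)).symm
      _ = _ := by rw [conv_comm]; rfl

/-- The contraction principle in mean. -/
lemma lintegral_enorm_convPow_map_le (μ : Measure B) [IsProbabilityMeasure μ] [μ.IsNegInvariant]
    {f g : B → B} {c : B → ℝ} (hf : Measurable f)
    (hg : Measurable g) (hc : Measurable c) (hc0 : ∀ x, 0 ≤ c x) (hc1 : ∀ x, c x ≤ 1)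
    (hceven : ∀ x, c (-x) = c x) (hgodd : ∀ x, g (-x) = -g x) (hfg : ∀ x, f x = c x • g x)
    (n : ℕ) : ∫⁻ x, ‖x‖ₑ ∂convPow (μ.map f) n ≤ ∫⁻ x, ‖x‖ₑ ∂convPow (μ.map g) n := by
  have := isProbabilityMeasure_map (μ := μ) hf.aemeasurable
  have := isProbabilityMeasure_map (μ := μ) hg.aemeasurable
  suffices h : ∀ z : B, ∫⁻ x, ‖z + x‖ₑ ∂μ.map f ≤ ∫⁻ x, ‖z + x‖ₑ ∂μ.map g by
    simpa using lintegral_convPow_mono h n 0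
  intro z
  rw [lintegral_map (by fun_prop) hf, lintegral_map (by fun_prop) hg]
  exact lintegral_enorm_add_le μ hg hc hc0 hc1 hceven hgodd hfg z

/-- Total variation errors add under convolution. Iterated, this charges a change of every summand
on a set `D` with at most `n * μ D`. -/
lemma conv_le_conv_add {μ ν μ' ν' : Measure B} [IsProbabilityMeasure μ] [IsProbabilityMeasure ν]
    [IsProbabilityMeasure μ'] [IsProbabilityMeasure ν'] {δ δ' : ℝ≥0∞}
    (h : ∀ A, MeasurableSet A → μ A ≤ ν A + δ) (h' : ∀ A, MeasurableSet A → μ' A ≤ ν' A + δ')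
    {A : Set B} (hA : MeasurableSet A) : (μ ∗ μ') A ≤ (ν ∗ ν') A + (δ + δ') := by
  have hm : ∀ x : B, MeasurableSet {y | x + y ∈ A} := fun x => measurable_const_add x hA
  have step : ∀ {ρ σ τ : Measure B} [IsProbabilityMeasure ρ] [IsProbabilityMeasure σ]
      [IsProbabilityMeasure τ] {η : ℝ≥0∞}, (∀ A, MeasurableSet A → ρ A ≤ σ A + η) →
      (τ ∗ ρ) A ≤ (τ ∗ σ) A + η := by
    intro ρ σ τ _ _ _ η hη
    rw [conv_apply _ _ hA, conv_apply _ _ hA]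
    calc _ ≤ ∫⁻ x, (σ {y | x + y ∈ A} + η) ∂τ := lintegral_mono fun x => hη _ (hm x)
      _ = _ := by rw [lintegral_add_right _ measurable_const]; simp
  calc (μ ∗ μ') A ≤ (μ ∗ ν') A + δ' := step h'
    _ = (ν' ∗ μ) A + δ' := by rw [conv_comm]
    _ ≤ (ν' ∗ ν) A + δ + δ' := by gcongr; exact step h
    _ = _ := by rw [conv_comm, add_assoc]

lemma convPow_le_convPow_add {μ ν : Measure B} [IsProbabilityMeasure μ] [IsProbabilityMeasure ν]
    {δ : ℝ≥0∞} (h : ∀ A, MeasurableSet A → μ A ≤ ν A + δ) (n : ℕ) :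
    ∀ A, MeasurableSet A → convPow μ n A ≤ convPow ν n A + n * δ := by
  induction n with
  | zero => intro A _; simp [convPow]
  | succ n ih =>
    intro A hA
    refine (conv_le_conv_add ih h hA).trans_eq ?_
    push_cast
    rw [add_mul, one_mul]; rfl

lemma map_le_map_add (μ : Measure B) {f g : B → B} (hf : Measurable f) (hg : Measurable g)
    {D : Set B} (hD : ∀ x, x ∉ D → f x = g x) (A : Set B) (hA : MeasurableSet A) :
    μ.map f A ≤ μ.map g A + μ D := by
  rw [map_apply hf hA, map_apply hg hA]
  refine (measure_mono fun x hx => ?_).trans (measure_union_le _ _)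
  by_cases hxD : x ∈ D
  · exact Or.inr hxD
  · exact Or.inl (by simpa [← hD x hxD] using hx)

lemma normTail_convPow_map_le (μ : Measure B) [IsProbabilityMeasure μ] {f g : B → B}
    (hf : Measurable f) (hg : Measurable g) {D : Set B} (hD : ∀ x, x ∉ D → f x = g x) (n : ℕ)
    (t : ℝ) : normTail (convPow (μ.map f) n) t ≤ normTail (convPow (μ.map g) n) t + n * μ D := by
  have := isProbabilityMeasure_map (μ := μ) hf.aemeasurable
  have := isProbabilityMeasure_map (μ := μ) hg.aemeasurable
  exact convPow_le_convPow_add (map_le_map_add μ hf hg hD) n _ (measurableSet_norm_gt t)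

end MeanBounds

/-! ### Transfer of the symmetric weak law from `a` to `b` -/

section Comparison

variable {B : Type*} [NormedAddCommGroup B] [NormedSpace ℝ B] [MeasurableSpace B] [BorelSpace B]
  [SecondCountableTopology B]

lemma convPow_map_addMonoidHom (μ : Measure B) [IsProbabilityMeasure μ] (L : B →+ B)
    (hL : Measurable L) (n : ℕ) : convPow (μ.map L) n = (convPow μ n).map L := by
  induction n with
  | zero => simp [convPow, map_dirac' hL]
  | succ n ih =>
    change convPow (μ.map L) n ∗ μ.map L = (convPow μ n ∗ μ).map L
    rw [ih, map_conv_addMonoidHom L hL]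

lemma convPow_map_neg (μ : Measure B) [IsProbabilityMeasure μ] (n : ℕ) :
    convPow (μ.map fun x => -x) n = (convPow μ n).map fun x => -x :=
  convPow_map_addMonoidHom μ (negAddMonoidHom : B →+ B) measurable_neg n

lemma convPow_conv (μ ν : Measure B) [IsProbabilityMeasure μ] [IsProbabilityMeasure ν] (n : ℕ) :
    convPow (μ ∗ ν) n = convPow μ n ∗ convPow ν n := by
  induction n with
  | zero => simp [convPow]
  | succ n ih =>
    change convPow (μ ∗ ν) n ∗ (μ ∗ ν) = (convPow μ n ∗ μ) ∗ (convPow ν n ∗ ν)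
    rw [ih, conv_assoc, conv_assoc, ← conv_assoc μ, ← conv_assoc (convPow ν n),
      conv_comm (convPow ν n) μ]

lemma isNegInvariant_map (μ : Measure B) [μ.IsNegInvariant] {f : B → B} (hf : Measurable f)
    (hodd : ∀ x, f (-x) = -f x) : (μ.map f).IsNegInvariant := by
  rw [isNegInvariant_iff, map_map measurable_neg hf]
  conv_rhs => rw [← (isNegInvariant_iff μ).1 inferInstance, map_map hf measurable_neg]
  congr 1
  ext x
  simp [hodd]

/-- Symmetric laws with tails `o(1 / n)` at `b n` satisfy the weak law of large numbers with
norming sequence `b`. -/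
def TailImpliesWeakLaw (B : Type*) [NormedAddCommGroup B] [MeasurableSpace B] (b : ℕ → ℝ) : Prop :=
  ∀ (ν : Measure B) [IsProbabilityMeasure ν] [ν.IsNegInvariant],
    Tendsto (fun n : ℕ => n * normTail ν (b n)) atTop (𝓝 0) →
      ∀ ε : ℝ, 0 < ε → Tendsto (fun n => normTail (convPow ν n) (ε * b n)) atTop (𝓝 0)

/-- The first positive index `n` with `t ≤ b n`. -/
noncomputable def firstIndex (b : ℕ → ℝ) (t : ℝ) : ℕ := sInf {n | 1 ≤ n ∧ t ≤ b n}

lemma firstIndex_mem {b : ℕ → ℝ} (hb : Tendsto b atTop atTop) (t : ℝ) :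
    1 ≤ firstIndex b t ∧ t ≤ b (firstIndex b t) := by
  have h : {n | 1 ≤ n ∧ t ≤ b n}.Nonempty :=
    ((eventually_ge_atTop 1).and (hb.eventually_ge_atTop t)).exists
  exact Nat.sInf_mem h

lemma firstIndex_le {b : ℕ → ℝ} {t : ℝ} {n : ℕ} (hn : 1 ≤ n) (h : t ≤ b n) :
    firstIndex b t ≤ n := Nat.sInf_le ⟨hn, h⟩

/-- A larger `t` leaves fewer admissible indices, so the first index is monotone in `t` whether or
not `b` is monotone. -/
lemma measurable_firstIndex {b : ℕ → ℝ} (hb : Tendsto b atTop atTop) :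
    Measurable (firstIndex b) := by
  refine Monotone.measurable fun s t hst => ?_
  exact firstIndex_le (firstIndex_mem hb t).1 (hst.trans (firstIndex_mem hb t).2)

/-- The radial map that sends the shells between consecutive `b n` to spheres of radius `a n`. -/
noncomputable def shellMap (a b : ℕ → ℝ) (x : B) : B := (a (firstIndex b ‖x‖) / ‖x‖) • x

lemma measurable_comp_firstIndex_norm (a : ℕ → ℝ) {b : ℕ → ℝ} (hb : Tendsto b atTop atTop) :
    Measurable fun x : B => a (firstIndex b ‖x‖) :=
  (measurable_from_top (f := a)).comp ((measurable_firstIndex hb).comp measurable_norm)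

lemma measurable_shellMap (a : ℕ → ℝ) {b : ℕ → ℝ} (hb : Tendsto b atTop atTop) :
    Measurable (shellMap a b : B → B) :=
  ((measurable_comp_firstIndex_norm a hb).div measurable_norm).smul measurable_id

lemma shellMap_neg (a b : ℕ → ℝ) (x : B) : shellMap a b (-x) = -shellMap a b x := by
  simp [shellMap]

lemma norm_shellMap_le {a b : ℕ → ℝ} {x : B} (h : 0 ≤ a (firstIndex b ‖x‖)) :
    ‖shellMap a b x‖ ≤ a (firstIndex b ‖x‖) := by
  rw [shellMap, norm_smul, norm_div, norm_norm, Real.norm_of_nonneg h]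
  rcases eq_or_ne ‖x‖ 0 with hx | hx
  · simpa [hx] using h
  · rw [div_mul_cancel₀ _ hx]

/-- Truncation of `f` outside the ball of radius `t`. -/
noncomputable def truncate (t : ℝ) (f : B → B) : B → B := {x | ‖x‖ ≤ t}.indicator f

lemma measurable_truncate (t : ℝ) {f : B → B} (hf : Measurable f) : Measurable (truncate t f) :=
  hf.indicator (measurableSet_norm_le t)

lemma truncate_of_le {t : ℝ} (f : B → B) {x : B} (h : ‖x‖ ≤ t) : truncate t f x = f x :=
  Set.indicator_of_mem (by exact h) _

lemma truncate_of_lt {t : ℝ} (f : B → B) {x : B} (h : t < ‖x‖) : truncate t f x = 0 :=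
  Set.indicator_of_notMem (by simpa using h) _

lemma truncate_neg (t : ℝ) {f : B → B} (hf : ∀ x, f (-x) = -f x) (x : B) :
    truncate t f (-x) = -truncate t f x := by
  rcases le_or_gt ‖x‖ t with h | h
  · rw [truncate_of_le _ h, truncate_of_le _ (by simpa using h), hf]
  · rw [truncate_of_lt _ h, truncate_of_lt _ (by simpa using h), neg_zero]

lemma truncate_eq_of_notMem (t : ℝ) (f : B → B) (x : B) (hx : x ∉ {x : B | t < ‖x‖}) :
    truncate t f x = f x := truncate_of_le f (by simpa using hx)

lemma tendsto_zero_of_le_add {f g h : ℕ → ℝ≥0∞} (hg : Tendsto g atTop (𝓝 0))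
    (hh : Tendsto h atTop (𝓝 0)) (hle : ∀ᶠ n in atTop, f n ≤ g n + h n) :
    Tendsto f atTop (𝓝 0) := by
  have := hg.add hh
  rw [add_zero] at this
  exact tendsto_of_tendsto_of_tendsto_of_le_of_le' tendsto_const_nhds this
    (Eventually.of_forall fun _ => zero_le) hle

lemma tendsto_zero_of_le {f g : ℕ → ℝ≥0∞} (hg : Tendsto g atTop (𝓝 0))
    (hle : ∀ᶠ n in atTop, f n ≤ g n) : Tendsto f atTop (𝓝 0) :=
  tendsto_of_tendsto_of_tendsto_of_le_of_le' tendsto_const_nhds hg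
    (Eventually.of_forall fun _ => zero_le) hle

lemma tendsto_const_mul_zero {f : ℕ → ℝ≥0∞} (hf : Tendsto f atTop (𝓝 0)) {C : ℝ≥0∞}
    (hC : C ≠ ∞) : Tendsto (fun n => C * f n) atTop (𝓝 0) := by
  simpa using ENNReal.Tendsto.const_mul hf (Or.inr hC)

/-- The comparison theorem for symmetric laws. -/
theorem TailImpliesWeakLaw.of_monotoneOn_div {a b : ℕ → ℝ}
    (ha_pos : ∀ n, 1 ≤ n → 0 < a n) (hb_pos : ∀ n, 1 ≤ n → 0 < b n)
    (ha_mono : MonotoneOn a (Set.Ici 1)) (hb_lim : Tendsto b atTop atTop)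
    (hba : MonotoneOn (fun n => b n / a n) (Set.Ici 1)) (H : TailImpliesWeakLaw B a) :
    TailImpliesWeakLaw B b := by
  intro ν _ _ hν ε hε
  have hΦ : Measurable (shellMap a b : B → B) := measurable_shellMap a hb_lim
  have haN : ∀ t : ℝ, 0 < a (firstIndex b t) := fun t => ha_pos _ (firstIndex_mem hb_lim t).1
  have : IsProbabilityMeasure (ν.map (shellMap a b)) := isProbabilityMeasure_map hΦ.aemeasurable
  have : (ν.map (shellMap a b)).IsNegInvariant := isNegInvariant_map ν hΦ (shellMap_neg a b)
  have hnorm : ∀ n, 1 ≤ n → ∀ x : B, ‖x‖ ≤ b n → ‖shellMap a b x‖ ≤ a n := fun n hn x hx =>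
    (norm_shellMap_le (haN _).le).trans
      (ha_mono (firstIndex_mem hb_lim _).1 hn (firstIndex_le hn hx))
  have htail : Tendsto (fun n : ℕ => n * normTail (ν.map (shellMap a b)) (a n)) atTop (𝓝 0) := by
    refine tendsto_zero_of_le hν ?_
    filter_upwards [eventually_ge_atTop 1] with n hn
    gcongr
    rw [normTail, map_apply hΦ (measurableSet_norm_gt _)]
    refine measure_mono fun x hx => ?_
    by_contra hx'
    exact absurd (hnorm n hn x (by simpa using hx')) (not_le.2 hx)
  -- Truncating by the size of `x` bounds the image by `a n`, as the passage to means requires.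
  set z : ℕ → B → B := fun n => truncate (b n) (shellMap a b) with hz
  have hzm : ∀ n, Measurable (z n) := fun n => measurable_truncate _ hΦ
  have hzodd : ∀ n x, z n (-x) = -z n x := fun n => truncate_neg _ (shellMap_neg a b)
  have : ∀ n, IsProbabilityMeasure (ν.map (z n)) := fun n =>
    isProbabilityMeasure_map (hzm n).aemeasurable
  have : ∀ n, (ν.map (z n)).IsNegInvariant := fun n => isNegInvariant_map ν (hzm n) (hzodd n)
  have hzT : ∀ ε : ℝ, 0 < ε →
      Tendsto (fun n => normTail (convPow (ν.map (z n)) n) (ε * a n)) atTop (𝓝 0) :=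
    fun ε hε => tendsto_zero_of_le_add (H _ htail ε hε) hν (Eventually.of_forall fun n =>
      normTail_convPow_map_le ν (hzm n) hΦ (truncate_eq_of_notMem _ _) n _)
  have hapos : ∀ᶠ n in atTop, 0 < a n := (eventually_ge_atTop 1).mono ha_pos
  have hzmean := fun ε (hε : 0 < ε) =>
    eventually_lintegral_enorm_convPow_le (fun n => ν.map (z n)) hapos (by
      filter_upwards [eventually_ge_atTop 1] with n hn
      rw [ae_map_iff (hzm n).aemeasurable (measurableSet_norm_le _)]
      refine ae_of_all _ fun x => ?_
      rcases le_or_gt ‖x‖ (b n) with h | h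
      · rw [hz]; simp only; rw [truncate_of_le _ h]; exact hnorm n hn x h
      · rw [hz]; simp only; rw [truncate_of_lt _ h, norm_zero]; exact (ha_pos n hn).le) hzT hε
  set y : ℕ → B → B := fun n => truncate (b n) id with hy
  have hym : ∀ n, Measurable (y n) := fun n => measurable_truncate _ measurable_id
  have : ∀ n, IsProbabilityMeasure (ν.map (y n)) := fun n =>
    isProbabilityMeasure_map (hym n).aemeasurable
  have hymean : ∀ ε : ℝ, 0 < ε → ∀ᶠ n in atTop,
      ∫⁻ x, ‖x‖ₑ ∂convPow (ν.map fun x => (a n / b n) • y n x) n ≤ ENNReal.ofReal (ε * a n) := by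
    intro ε hε
    filter_upwards [hzmean ε hε, eventually_ge_atTop 1] with n hn h1
    have ha := ha_pos n h1
    have hb := hb_pos n h1
    refine le_trans ?_ hn
    refine lintegral_enorm_convPow_map_le ν
      -- The factor is forced by $(a_n/b_n)x=c(x)\,a_N x/\|x\|$. It is at most 1 because $\|x\|\le
      -- b_N$ and $b_N/a_N\le b_n/a_n$ for $N\le n$.
      (c := {x | ‖x‖ ≤ b n}.indicator fun x => ‖x‖ * a n / (b n * a (firstIndex b ‖x‖)))
      ((hym n).const_smul _) (hzm n)
      (((measurable_norm.mul_const _).div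
        ((measurable_comp_firstIndex_norm a hb_lim).const_mul _)).indicator
        (measurableSet_norm_le _)) ?_ ?_ ?_ (hzodd n) ?_ n
    · intro x
      refine Set.indicator_nonneg (fun x _ => ?_) x
      have := haN ‖x‖
      positivity
    · intro x
      refine Set.indicator_le' (fun x hx => ?_) (fun _ _ => zero_le_one) x
      have hN := haN ‖x‖
      obtain ⟨hN1, hN2⟩ := firstIndex_mem hb_lim ‖x‖
      have h2 := hba hN1 h1 (firstIndex_le h1 hx)
      simp only at h2
      rw [div_le_div_iff₀ hN ha] at h2
      rw [div_le_one (by positivity)]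
      nlinarith
    · intro x
      simp [Set.indicator]
    · intro x
      rcases le_or_gt ‖x‖ (b n) with h | h
      · have hN := haN ‖x‖
        simp only [hy, hz, Pi.smul_apply, truncate_of_le _ h, id]
        rw [Set.indicator_of_mem (by exact h), shellMap, smul_smul]
        rcases eq_or_ne x 0 with hx | hx
        · simp [hx]
        have hx0 : ‖x‖ ≠ 0 := norm_ne_zero_iff.2 hx
        congr 1
        field_simp
      · simp only [hy, hz, Pi.smul_apply, truncate_of_lt _ h, smul_zero]
  have hyT := tendsto_normTail_of_lintegral_enorm_le hapos hymean hε
  refine tendsto_zero_of_le_add hyT hν ?_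
  filter_upwards [eventually_ge_atTop 1] with n h1
  have ha := ha_pos n h1
  have hb := hb_pos n h1
  have h2 : normTail (convPow (ν.map fun x => (a n / b n) • y n x) n) (ε * a n) =
      normTail (convPow (ν.map (y n)) n) (ε * b n) := by
    have h3 : ν.map (fun x => (a n / b n) • y n x) =
        (ν.map (y n)).map (DistribSMul.toAddMonoidHom B (a n / b n)) := by
      rw [map_map (by exact measurable_const_smul (a n / b n)) (hym n)]; rfl
    rw [h3, convPow_map_addMonoidHom _ _ (by exact measurable_const_smul (a n / b n)), normTail,
      map_apply (by exact measurable_const_smul (a n / b n)) (measurableSet_norm_gt _), normTail]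
    congr 1
    ext x
    simp only [Set.mem_preimage, Set.mem_ofPred_eq, DistribSMul.toAddMonoidHom_apply]
    rw [norm_smul, Real.norm_of_nonneg (by positivity), div_mul_eq_mul_div, lt_div_iff₀ hb]
    constructor <;> intro h <;> nlinarith
  rw [h2]
  have := normTail_convPow_map_le ν measurable_id (hym n) (D := {x | b n < ‖x‖})
    (fun x hx => (truncate_eq_of_notMem _ _ x hx).symm) n (ε * b n)
  rwa [Measure.map_id] at this

end Comparison

/-! ### Symmetrization and laws that need not be symmetric -/

section GeneralLaws

variable {B : Type*} [NormedAddCommGroup B] [NormedSpace ℝ B] [MeasurableSpace B] [BorelSpace B]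
  [SecondCountableTopology B]

instance (μ : Measure B) [IsProbabilityMeasure μ] : IsProbabilityMeasure (μ.map fun x => -x) :=
  isProbabilityMeasure_map measurable_neg.aemeasurable

lemma normTail_map_neg (μ : Measure B) (t : ℝ) :
    normTail (μ.map fun x => -x) t = normTail μ t := by
  rw [normTail, map_apply measurable_neg (measurableSet_norm_gt t), normTail]
  simp

lemma map_neg_map_neg (μ : Measure B) : (μ.map fun x => -x).map (fun x => -x) = μ := by
  rw [map_map measurable_neg measurable_neg]
  simp

/-- The law of `ε X`, where `X` has law `μ` and `ε` is an independent random sign. -/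
noncomputable def signSymm (μ : Measure B) : Measure B :=
  (2⁻¹ : ℝ≥0∞) • (μ + μ.map fun x => -x)

instance (μ : Measure B) [IsProbabilityMeasure μ] : IsProbabilityMeasure (signSymm μ) := by
  constructor
  simp only [signSymm, Measure.smul_apply, Measure.add_apply, measure_univ, smul_eq_mul]
  rw [one_add_one_eq_two, ENNReal.inv_mul_cancel (by simp) (by simp)]

instance (μ : Measure B) : (signSymm μ).IsNegInvariant := by
  rw [isNegInvariant_iff, signSymm, Measure.map_smul, Measure.map_add _ _ measurable_neg,
    map_neg_map_neg, add_comm]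

/-- A random sign preserves the norm exactly, so statements about tails alone reduce to symmetric
laws without loss. Differences are needed when the sums themselves must be controlled. -/
lemma normTail_signSymm (μ : Measure B) (t : ℝ) : normTail (signSymm μ) t = normTail μ t := by
  have h : normTail (signSymm μ) t =
      2⁻¹ * (normTail μ t + normTail (μ.map fun x => -x) t) := rfl
  rw [h, normTail_map_neg, ← two_mul, ← mul_assoc, ENNReal.inv_mul_cancel (by simp) (by simp),
    one_mul]

/-- The law of `X - X'`, where `X` and `X'` are independent with law `μ`. -/
noncomputable def diffSymm (μ : Measure B) : Measure B := μ ∗ μ.map fun x => -x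

instance (μ : Measure B) [IsProbabilityMeasure μ] : IsProbabilityMeasure (diffSymm μ) :=
  inferInstanceAs (IsProbabilityMeasure (_ ∗ _))

instance (μ : Measure B) [IsProbabilityMeasure μ] : (diffSymm μ).IsNegInvariant := by
  rw [isNegInvariant_iff, diffSymm, map_neg_conv, map_neg_map_neg, conv_comm]

lemma convPow_diffSymm (μ : Measure B) [IsProbabilityMeasure μ] (n : ℕ) :
    convPow (diffSymm μ) n = diffSymm (convPow μ n) := by
  rw [diffSymm, convPow_conv, convPow_map_neg, diffSymm]

lemma diffSymm_apply (μ : Measure B) [IsProbabilityMeasure μ] {A : Set B} (hA : MeasurableSet A) :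
    diffSymm μ A = ∫⁻ x, μ {y | x - y ∈ A} ∂μ := by
  rw [diffSymm, conv_apply _ _ hA]
  refine lintegral_congr fun x => ?_
  rw [map_apply measurable_neg (by exact measurable_const_add x hA)]
  simp [sub_eq_add_neg]

lemma measurableSet_norm_sub_gt (m : B) (t : ℝ) : MeasurableSet {x : B | t < ‖x - m‖} :=
  measurableSet_lt measurable_const (by fun_prop)

/-- If $x$ and $y$ are both within $t$ of $m$, then $\|x-y\|\le 2t$. The centre is arbitrary, so
symmetrization removes any centering. -/
lemma normTail_diffSymm_le (μ : Measure B) [IsProbabilityMeasure μ] (m : B) (t : ℝ) :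
    normTail (diffSymm μ) (2 * t) ≤ 2 * μ {x | t < ‖x - m‖} := by
  rw [normTail, diffSymm_apply _ (measurableSet_norm_gt _)]
  calc ∫⁻ x, μ {y | x - y ∈ {z | 2 * t < ‖z‖}} ∂μ
      ≤ ∫⁻ x, ({x | t < ‖x - m‖}.indicator (fun _ => 1) x + μ {x | t < ‖x - m‖}) ∂μ := by
        refine lintegral_mono fun x => ?_
        by_cases hx : t < ‖x - m‖
        · rw [Set.indicator_of_mem (by exact hx)]
          exact prob_le_one.trans le_self_add
        · refine le_add_of_le_right (measure_mono fun y hy => ?_)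
          have hy' : 2 * t < ‖x - y‖ := hy
          change t < ‖y - m‖
          have := norm_sub_le (x - m) (y - m)
          rw [sub_sub_sub_cancel_right] at this
          linarith
    _ = _ := by
      rw [lintegral_add_right _ measurable_const,
        lintegral_indicator_const (measurableSet_norm_sub_gt m t)]
      simp [two_mul]

/-- Weak symmetrization: half of the tail of `μ` survives in the tail of `diffSymm μ`. -/
lemma normTail_le_two_mul_normTail_diffSymm (μ : Measure B) [IsProbabilityMeasure μ] {r t : ℝ}
    (hr : 2⁻¹ ≤ μ {x | ‖x‖ ≤ r}) :
    normTail μ (t + r) ≤ 2 * normTail (diffSymm μ) t := by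
  have h : 2⁻¹ * normTail μ (t + r) ≤ normTail (diffSymm μ) t := by
    conv_rhs => rw [normTail, diffSymm_apply _ (measurableSet_norm_gt _)]
    calc 2⁻¹ * normTail μ (t + r)
        = ∫⁻ x, {x : B | t + r < ‖x‖}.indicator (fun _ => 2⁻¹) x ∂μ :=
          (lintegral_indicator_const (measurableSet_norm_gt _) _).symm
      _ ≤ _ := by
        refine lintegral_mono fun x => ?_
        by_cases hx : t + r < ‖x‖
        swap
        · rw [Set.indicator_of_notMem (by exact hx)]
          exact zero_le
        rw [Set.indicator_of_mem (by exact hx)]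
        refine hr.trans (measure_mono fun y hy => ?_)
        have hy' : ‖y‖ ≤ r := hy
        change t < ‖x - y‖
        linarith [norm_sub_norm_le x y]
  calc normTail μ (t + r) = 2 * (2⁻¹ * normTail μ (t + r)) := by
        rw [← mul_assoc, ENNReal.mul_inv_cancel (by simp) (by simp), one_mul]
    _ ≤ _ := by gcongr

lemma exists_two_inv_le_measure_norm_le (μ : Measure B) [IsProbabilityMeasure μ] :
    ∃ r : ℝ, 2⁻¹ ≤ μ {x | ‖x‖ ≤ r} := by
  have hmono : Monotone fun k : ℕ => {x : B | ‖x‖ ≤ k} := fun i j hij x hx =>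
    le_trans (show ‖x‖ ≤ i from hx) (by exact_mod_cast hij)
  have hU : ⋃ k : ℕ, {x : B | ‖x‖ ≤ k} = Set.univ := by
    ext x
    simpa using exists_nat_ge ‖x‖
  have h := tendsto_measure_iUnion_atTop (μ := μ) hmono
  rw [hU, measure_univ] at h
  obtain ⟨k, hk⟩ := (h.eventually_const_le (by simp : (2⁻¹ : ℝ≥0∞) < 1)).exists
  exact ⟨k, hk⟩

lemma integrable_id_conv {μ ν : Measure B} [IsProbabilityMeasure μ] [IsProbabilityMeasure ν]
    (hμ : Integrable id μ) (hν : Integrable id ν) :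
    Integrable id (μ ∗ ν) ∧ ∫ x, x ∂(μ ∗ ν) = ∫ x, x ∂μ + ∫ x, x ∂ν := by
  have h1 : Integrable (fun p : B × B => p.1) (μ.prod ν) := hμ.comp_fst ν
  have h2 : Integrable (fun p : B × B => p.2) (μ.prod ν) := hν.comp_snd μ
  constructor
  · rw [Measure.conv, integrable_map_measure (by fun_prop) (by fun_prop)]
    exact h1.add h2
  · rw [Measure.conv, integral_map (by fun_prop) (by fun_prop), integral_add h1 h2]
    congr 1
    · simpa using integral_fun_fst (μ := μ) (ν := ν) (fun x : B => x)
    · simpa using integral_fun_snd (μ := μ) (ν := ν) (fun x : B => x)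

lemma integrable_id_convPow {μ : Measure B} [IsProbabilityMeasure μ] (hμ : Integrable id μ)
    (n : ℕ) [CompleteSpace B] :
    Integrable id (convPow μ n) ∧ ∫ x, x ∂convPow μ n = (n : ℝ) • ∫ x, x ∂μ := by
  induction n with
  | zero => simp [convPow, integrable_dirac]
  | succ n ih =>
    obtain ⟨h1, h2⟩ := integrable_id_conv ih.1 hμ
    refine ⟨h1, h2.trans ?_⟩
    rw [ih.2]
    push_cast
    rw [add_smul, one_smul]

/-- The mean distance to the mean is at most that to an independent copy. -/
lemma lintegral_enorm_sub_integral_le [CompleteSpace B] {μ : Measure B} [IsProbabilityMeasure μ]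
    (hμ : Integrable id μ) :
    ∫⁻ x, ‖x - ∫ y, y ∂μ‖ₑ ∂μ ≤ ∫⁻ x, ‖x‖ₑ ∂diffSymm μ := by
  have h1 : ∫⁻ x, ‖x‖ₑ ∂diffSymm μ = ∫⁻ x, ∫⁻ y, ‖x - y‖ₑ ∂μ ∂μ := by
    rw [diffSymm, lintegral_conv (by fun_prop)]
    refine lintegral_congr fun x => ?_
    rw [lintegral_map (by fun_prop) measurable_neg]
    simp [sub_eq_add_neg]
  rw [h1]
  refine lintegral_mono fun x => ?_
  have h2 : x - ∫ y, y ∂μ = ∫ y, (x - y) ∂μ := by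
    rw [integral_sub (g := fun y => y) (integrable_const x) hμ]; simp
  rw [h2]
  exact enorm_integral_le_lintegral_enorm _

/-- Under the weak law for `b`, tails `o(1 / n)` at `b n` are `o(1 / n)` at `δ * b n`. -/
lemma TailImpliesWeakLaw.tendsto_mul_normTail {b : ℕ → ℝ} (H : TailImpliesWeakLaw B b)
    (μ : Measure B) [IsProbabilityMeasure μ]
    (hμ : Tendsto (fun n : ℕ => n * normTail μ (b n)) atTop (𝓝 0)) {δ : ℝ} (hδ : 0 < δ) :
    Tendsto (fun n : ℕ => n * normTail μ (δ * b n)) atTop (𝓝 0) := by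
  -- The weak law makes the sums small at every level `δ * b n`, and Lévy's inequality turns this
  -- back into a bound on single tails.
  have h := H (signSymm μ) (by simpa only [normTail_signSymm] using hμ) δ hδ
  refine tendsto_zero_of_le (tendsto_const_mul_zero h (C := 4) (by simp)) ?_
  filter_upwards [h.eventually_le_const (by simp : (0 : ℝ≥0∞) < 4⁻¹)] with n hn
  simpa only [normTail_signSymm] using mul_normTail_le_four_mul (signSymm μ) (δ * b n) n hn

/-- The mean of the truncated sum. -/
noncomputable def truncatedMean (μ : Measure B) (n : ℕ) (t : ℝ) : B :=
  (n : ℝ) • ∫ x, truncate t id x ∂μ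

/-- The centered weak law of large numbers for general laws. -/
theorem TailImpliesWeakLaw.tendsto_centered [CompleteSpace B] {b : ℕ → ℝ}
    (H : TailImpliesWeakLaw B b) (hb_pos : ∀ n, 1 ≤ n → 0 < b n)
    (μ : Measure B) [IsProbabilityMeasure μ]
    (hμ : Tendsto (fun n : ℕ => n * normTail μ (b n)) atTop (𝓝 0)) {ε : ℝ} (hε : 0 < ε) :
    Tendsto (fun n => convPow μ n {x | ε * b n < ‖x - truncatedMean μ n (b n)‖}) atTop
      (𝓝 0) := by
  have hbpos : ∀ᶠ n in atTop, 0 < 2 * b n :=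
    (eventually_ge_atTop 1).mono fun n hn => by have := hb_pos n hn; positivity
  set y : ℕ → B → B := fun n => truncate (b n) id with hy
  have hym : ∀ n, Measurable (y n) := fun n => measurable_truncate _ measurable_id
  have : ∀ n, IsProbabilityMeasure (μ.map (y n)) := fun n =>
    isProbabilityMeasure_map (hym n).aemeasurable
  have hyle : ∀ n, 1 ≤ n → ∀ x, ‖y n x‖ ≤ b n := by
    intro n hn x
    rcases le_or_gt ‖x‖ (b n) with h | h
    · simp only [hy, truncate_of_le _ h]; exact h
    · simpa only [hy, truncate_of_lt _ h, norm_zero] using (hb_pos n hn).le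
  -- A difference exceeding $b_n$ needs a term exceeding $b_n/2$, so the tail must first be improved
  -- to level $b_n/2$.
  have hdiff : Tendsto (fun n : ℕ => n * normTail (diffSymm μ) (b n)) atTop (𝓝 0) := by
    have h2 := H.tendsto_mul_normTail μ hμ (δ := 2⁻¹) (by norm_num)
    refine tendsto_zero_of_le (tendsto_const_mul_zero h2 (C := 2) (by simp))
      (Eventually.of_forall fun n => ?_)
    have h3 := normTail_diffSymm_le μ 0 (2⁻¹ * b n)
    rw [← mul_assoc, mul_inv_cancel₀ two_ne_zero, one_mul] at h3
    simp only [sub_zero] at h3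
    calc (n : ℝ≥0∞) * normTail (diffSymm μ) (b n) ≤ n * (2 * normTail μ (2⁻¹ * b n)) := by
          gcongr; exact h3
      _ = _ := by ring
  have hS := H (diffSymm μ) hdiff
  have hcomp : ∀ (n : ℕ) (t : ℝ), normTail (convPow (diffSymm (μ.map (y n))) n) t ≤
      normTail (convPow (diffSymm μ) n) t + 2 * (n * normTail μ (b n)) := by
    intro n t
    have h1 : ∀ A, MeasurableSet A → μ.map (y n) A ≤ μ A + normTail μ (b n) := by
      intro A hA
      have := map_le_map_add μ (hym n) measurable_id (truncate_eq_of_notMem (b n) id) A hA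
      rwa [Measure.map_id] at this
    have h2 : ∀ A, MeasurableSet A → (μ.map (y n)).map (fun x => -x) A ≤
        μ.map (fun x => -x) A + normTail μ (b n) := by
      intro A hA
      rw [map_apply measurable_neg hA, map_apply measurable_neg hA]
      exact h1 _ (measurable_neg hA)
    have h3 := convPow_le_convPow_add (fun A hA => conv_le_conv_add h1 h2 hA) n _
      (measurableSet_norm_gt t)
    refine h3.trans_eq ?_
    rw [← two_mul, mul_left_comm]; rfl
  have hT : ∀ ε : ℝ, 0 < ε →
      Tendsto (fun n => normTail (convPow (diffSymm (μ.map (y n))) n) (ε * (2 * b n))) atTop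
        (𝓝 0) := by
    intro ε hε
    refine tendsto_zero_of_le_add (hS (ε * 2) (by positivity))
      (tendsto_const_mul_zero hμ (C := 2) (by simp)) (Eventually.of_forall fun n => ?_)
    rw [← mul_assoc]
    exact hcomp n _
  have hbdd : ∀ᶠ n in atTop, ∀ᵐ x ∂diffSymm (μ.map (y n)), ‖x‖ ≤ 2 * b n := by
    filter_upwards [eventually_ge_atTop 1] with n hn
    rw [ae_iff]
    simp only [not_le]
    refine le_antisymm ((normTail_diffSymm_le (μ.map (y n)) 0 (b n)).trans ?_) zero_le
    rw [map_apply (hym n) (measurableSet_norm_sub_gt _ _)]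
    have : y n ⁻¹' {x | b n < ‖x - 0‖} = ∅ := by
      ext x; simpa using hyle n hn x
    rw [this, measure_empty, mul_zero]
  have hint : ∀ n, 1 ≤ n → Integrable id (μ.map (y n)) := by
    intro n hn
    rw [integrable_map_measure (by fun_prop) (hym n).aemeasurable]
    exact Integrable.of_bound (hym n).aestronglyMeasurable (b n) (ae_of_all _ (hyle n hn))
  have hmean : ∀ n, ∫ x, x ∂μ.map (y n) = ∫ x, truncate (b n) id x ∂μ := fun n =>
    integral_map (hym n).aemeasurable (by fun_prop)
  have hcm : ∀ n, Measurable fun x : B => x - truncatedMean μ n (b n) := fun n => by fun_prop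
  -- The truncated sum has mean `truncatedMean μ n (b n)`; by Jensen its mean distance from it is at
  -- most that from an independent copy. Differences of truncated vectors are bounded by $2b_n$,
  -- hence that scale.
  have hL : ∀ ε : ℝ, 0 < ε → ∀ᶠ n in atTop,
      ∫⁻ x, ‖x‖ₑ ∂(convPow (μ.map (y n)) n).map (fun x => x - truncatedMean μ n (b n)) ≤
        ENNReal.ofReal (ε * (2 * b n)) := by
    intro ε hε
    filter_upwards [eventually_lintegral_enorm_convPow_le (fun n => diffSymm (μ.map (y n)))
      hbpos hbdd hT hε, eventually_ge_atTop 1] with n hn h1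
    refine le_trans ?_ hn
    obtain ⟨hi, hm⟩ := integrable_id_convPow (hint n h1) n
    rw [lintegral_map (by fun_prop) (hcm n), convPow_diffSymm, truncatedMean, ← hmean, ← hm]
    exact lintegral_enorm_sub_integral_le hi
  have hfin := tendsto_normTail_of_lintegral_enorm_le hbpos hL (half_pos hε)
  refine tendsto_zero_of_le_add hfin hμ (Eventually.of_forall fun n => ?_)
  have h1 : ∀ A, MeasurableSet A → μ A ≤ μ.map (y n) A + normTail μ (b n) := by
    intro A hA
    have := map_le_map_add μ measurable_id (hym n)
      (fun x hx => (truncate_eq_of_notMem (b n) id x hx).symm) A hA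
    rwa [Measure.map_id] at this
  refine (convPow_le_convPow_add h1 n _ (measurableSet_norm_sub_gt _ _)).trans_eq ?_
  have h2 : normTail ((convPow (μ.map (y n)) n).map fun x => x - truncatedMean μ n (b n))
      (ε / 2 * (2 * b n)) = convPow (μ.map (y n)) n {x | ε * b n < ‖x - truncatedMean μ n (b n)‖} := by
    rw [normTail, map_apply (hcm n) (measurableSet_norm_gt _)]
    congr 1
    ext x
    simp only [Set.mem_preimage, Set.mem_ofPred_eq]
    ring_nf
  rw [h2]

/-- The converse: convergence at a single level `lam * b n` forces tails `o(1 / n)` at `b n`. -/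
theorem TailImpliesWeakLaw.tendsto_mul_normTail_of_centered {b : ℕ → ℝ} {lam : ℝ}
    (hlam : 0 < lam) (H : TailImpliesWeakLaw B fun n => 2 * (lam * b n))
    (hb_lim : Tendsto b atTop atTop) (μ : Measure B) [IsProbabilityMeasure μ] (m : ℕ → B)
    (hμ : Tendsto (fun n => convPow μ n {x | lam * b n < ‖x - m n‖}) atTop (𝓝 0)) :
    Tendsto (fun n : ℕ => n * normTail μ (b n)) atTop (𝓝 0) := by
  have h1 : Tendsto (fun n => normTail (convPow (diffSymm μ) n) (2 * (lam * b n))) atTop (𝓝 0) := by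
    refine tendsto_zero_of_le (tendsto_const_mul_zero hμ (C := 2) (by simp))
      (Eventually.of_forall fun n => ?_)
    rw [convPow_diffSymm]
    exact normTail_diffSymm_le _ (m n) _
  have h2 : Tendsto (fun n : ℕ => n * normTail (diffSymm μ) (2 * (lam * b n))) atTop (𝓝 0) := by
    refine tendsto_zero_of_le (tendsto_const_mul_zero h1 (C := 4) (by simp)) ?_
    filter_upwards [h1.eventually_le_const (by simp : (0 : ℝ≥0∞) < 4⁻¹)] with n hn
    exact mul_normTail_le_four_mul (diffSymm μ) _ n hn
  -- This `δ` lowers $2\lambda b_n$ to $b_n/2$; the other half of $b_n$ eventually covers the radius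
  -- `r` lost in desymmetrization.
  have h3 := H.tendsto_mul_normTail (diffSymm μ) h2 (δ := (4 * lam)⁻¹) (by positivity)
  obtain ⟨r, hr⟩ := exists_two_inv_le_measure_norm_le μ
  refine tendsto_zero_of_le (tendsto_const_mul_zero h3 (C := 2) (by simp)) ?_
  filter_upwards [hb_lim.eventually_ge_atTop (2 * r)] with n hn
  have h4 : (4 * lam)⁻¹ * (2 * (lam * b n)) = b n / 2 := by field_simp; norm_num
  rw [h4]
  calc (n : ℝ≥0∞) * normTail μ (b n) ≤ n * normTail μ (b n / 2 + r) := by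
        gcongr; exact normTail_anti μ (by linarith)
    _ ≤ n * (2 * normTail (diffSymm μ) (b n / 2)) := by
        gcongr; exact normTail_le_two_mul_normTail_diffSymm μ hr
    _ = _ := by ring

end GeneralLaws

/-! ### From random sequences to laws and back -/

section Transfer

lemma measurable_partialSum {Ω B : Type*} [MeasurableSpace Ω] [NormedAddCommGroup B]
    [MeasurableSpace B] [BorelSpace B] [SecondCountableTopology B]
    {P : Measure Ω} {X : ℕ → Ω → B} (hX : IsIIDSeq P X) (n : ℕ) :
    Measurable (partialSum X n) :=
  Finset.measurable_sum _ fun i _ => hX.measurable i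

lemma map_partialSum_eq_convPow {Ω B : Type*} [MeasurableSpace Ω] [NormedAddCommGroup B]
    [MeasurableSpace B] [BorelSpace B] [SecondCountableTopology B]
    {P : Measure Ω} [IsProbabilityMeasure P] {X : ℕ → Ω → B} (hX : IsIIDSeq P X) (n : ℕ) :
    P.map (partialSum X n) = convPow (P.map (X 0)) n := by
  induction n with
  | zero =>
    have : partialSum X 0 = fun _ => 0 := by ext; simp [partialSum]
    rw [this, Measure.map_const, measure_univ, one_smul]; rfl
  | succ n ih =>
    have hind : IndepFun (partialSum X n) (X n) P := by
      have := hX.indep.indepFun_sum_range_succ hX.measurable n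
      convert this using 1
      ext ω; simp [partialSum]
    have hsum : partialSum X (n + 1) = partialSum X n + X n := by
      ext ω; simp [partialSum, Finset.sum_range_succ]
    rw [hsum, hind.map_add_eq_map_conv_map (measurable_partialSum hX n) (hX.measurable n), ih,
      (hX.identDistrib n).map_eq]
    rfl

/-- A law on a standard Borel space is the image of the uniform law on the unit interval. Sampling
from lifted intervals places the probability space in any universe `v`, independently of that of
`B`. -/
lemma exists_iidSeq {B : Type u} [MeasurableSpace B] [StandardBorelSpace B]
    (ν : Measure B) [IsProbabilityMeasure ν] :
    ∃ (Ω : Type v) (_ : MeasurableSpace Ω) (P : Measure Ω) (_ : IsProbabilityMeasure P)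
      (X : ℕ → Ω → B), IsIIDSeq P X ∧ ∀ i, P.map (X i) = ν := by
  have : Nonempty B := nonempty_of_isProbabilityMeasure ν
  obtain ⟨f, hf, hfν⟩ := Measure.exists_measurable_map_eq ν
  have hg : Measurable fun x : ULift.{v} unitInterval => f x.down := hf.comp measurable_down
  let ρ : Measure (ULift.{v} unitInterval) := (volume : Measure unitInterval).map ULift.up
  have : IsProbabilityMeasure ρ := isProbabilityMeasure_map measurable_up.aemeasurable
  have hlaw : ∀ i : ℕ, (infinitePi fun _ : ℕ => ρ).map (fun ω => f (ω i).down) = ν := by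
    intro i
    rw [← hfν, show (fun ω : ℕ → ULift.{v} unitInterval => f (ω i).down) =
      (fun x : ULift.{v} unitInterval => f x.down) ∘ (fun ω => ω i) from rfl,
      ← Measure.map_map hg (measurable_pi_apply i), infinitePi_map_eval,
      Measure.map_map hg measurable_up]
    rfl
  refine ⟨ℕ → ULift.{v} unitInterval, inferInstance, infinitePi fun _ => ρ, inferInstance,
    fun i ω => f (ω i).down, ⟨fun i => hg.comp (measurable_pi_apply i),
      iIndepFun_infinitePi fun _ => hg, fun i => ⟨?_, ?_, ?_⟩⟩, hlaw⟩
  · exact (hg.comp (measurable_pi_apply i)).aemeasurable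
  · exact (hg.comp (measurable_pi_apply 0)).aemeasurable
  · exact (hlaw i).trans (hlaw 0).symm

variable {B : Type u} [NormedAddCommGroup B] [NormedSpace ℝ B] [MeasurableSpace B] [BorelSpace B]
  [SecondCountableTopology B]

lemma normTail_map {Ω : Type*} [MeasurableSpace Ω] (P : Measure Ω) {Y : Ω → B}
    (hY : Measurable Y) (t : ℝ) : normTail (P.map Y) t = P {ω | t < ‖Y ω‖} := by
  rw [normTail, map_apply hY (measurableSet_norm_gt t)]; rfl

lemma tailImpliesWeakLaw_of_iidSeq [CompleteSpace B] {a : ℕ → ℝ}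
    (ha_pos : ∀ n, 1 ≤ n → 0 < a n)
    (h : ∀ (Ω : Type v) [MeasurableSpace Ω] (P : Measure Ω) [IsProbabilityMeasure P]
      (X : ℕ → Ω → B), IsIIDSeq P X → IsSymmetricRV P (X 0) →
        Tendsto (fun n : ℕ => (n : ℝ≥0∞) * P {ω | a n < ‖X 0 ω‖}) atTop (𝓝 0) →
        TendstoInMeasure P (fun n ω => (a n)⁻¹ • partialSum X n ω) atTop (fun _ => 0)) :
    TailImpliesWeakLaw B a := by
  intro ν _ _ hν ε hε
  have : PolishSpace B := inferInstance
  obtain ⟨Ω, _, P, _, X, hX, hlaw⟩ := exists_iidSeq.{u, v} ν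
  have hsym : IsSymmetricRV P (X 0) := by
    refine ⟨(hX.measurable 0).aemeasurable, (hX.measurable 0).neg.aemeasurable, ?_⟩
    have h1 : P.map (fun ω => -X 0 ω) = (P.map (X 0)).map fun x => -x :=
      (Measure.map_map measurable_neg (hX.measurable 0)).symm
    rw [h1, hlaw, (isNegInvariant_iff ν).1 inferInstance]
  have h2 := h Ω P X hX hsym (by simpa only [← normTail_map P (hX.measurable 0), hlaw] using hν)
  rw [tendstoInMeasure_iff_norm] at h2
  refine tendsto_zero_of_le (h2 ε hε) ?_
  filter_upwards [eventually_ge_atTop 1] with n hn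
  have ha := ha_pos n hn
  rw [← hlaw 0, ← map_partialSum_eq_convPow hX, normTail_map P (measurable_partialSum hX n)]
  refine measure_mono fun ω hω => ?_
  have hω' : ε * a n < ‖partialSum X n ω‖ := hω
  change ε ≤ ‖(a n)⁻¹ • partialSum X n ω - 0‖
  rw [sub_zero, norm_smul, norm_inv, Real.norm_of_nonneg ha.le, inv_mul_eq_div, le_div_iff₀ ha]
  exact hω'.le

lemma truncatedCentering_eq {Ω : Type*} [MeasurableSpace Ω] (P : Measure Ω) {Y : Ω → B}
    (hY : Measurable Y) (n : ℕ) (c : ℝ) :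
    truncatedCentering P Y n c = truncatedMean (P.map Y) n c := by
  rw [truncatedCentering, truncatedMean, integral_map hY.aemeasurable
    (measurable_truncate c measurable_id).aestronglyMeasurable]
  rfl

end Transfer

end WeakLaw

open WeakLaw

theorem theorem1p1 {B : Type u} [NormedAddCommGroup B] [NormedSpace ℝ B] [CompleteSpace B]
    [TopologicalSpace.SeparableSpace B] [MeasurableSpace B] [BorelSpace B]
    (a b : ℕ → ℝ)
    (ha_pos : ∀ n, 1 ≤ n → 0 < a n) (hb_pos : ∀ n, 1 ≤ n → 0 < b n)
    (ha_mono : MonotoneOn a (Set.Ici 1)) (hb_mono : MonotoneOn b (Set.Ici 1))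
    (ha_lim : Tendsto a atTop atTop)
    (hba : MonotoneOn (fun n => b n / a n) (Set.Ici 1))
    (hsymm : ∀ (Ω : Type v) [MeasurableSpace Ω] (P : Measure Ω) [IsProbabilityMeasure P]
      (X : ℕ → Ω → B), IsIIDSeq P X → IsSymmetricRV P (X 0) →
        (TendstoInMeasure P (fun n ω => (a n)⁻¹ • partialSum X n ω) atTop (fun _ => 0) ↔
          Tendsto (fun n : ℕ => (n : ℝ≥0∞) * P {ω | a n < ‖X 0 ω‖}) atTop (𝓝 0))) :
    ∀ (Ω : Type v) [MeasurableSpace Ω] (P : Measure Ω) [IsProbabilityMeasure P]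
      (X : ℕ → Ω → B), IsIIDSeq P X →
        (Tendsto (fun n : ℕ => (n : ℝ≥0∞) * P {ω | b n < ‖X 0 ω‖}) atTop (𝓝 0) →
          TendstoInMeasure P
            (fun n ω => (b n)⁻¹ • (partialSum X n ω - truncatedCentering P (X 0) n (b n)))
            atTop (fun _ => 0)) ∧
        (0 < limsup (fun n : ℕ => (n : ℝ≥0∞) * P {ω | b n < ‖X 0 ω‖}) atTop →
          ∀ lam : ℝ, 0 < lam →
            0 < limsup (fun n : ℕ =>
              P {ω | lam < ‖partialSum X n ω - truncatedCentering P (X 0) n (b n)‖ / b n})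
              atTop) := by
  have : SecondCountableTopology B := UniformSpace.secondCountable_of_separable B
  -- Monotonicity of the ratio gives $b_n\ge (b_1/a_1)\,a_n$.
  have hb_lim : Tendsto b atTop atTop := by
    refine tendsto_atTop_mono' atTop ?_
      (ha_lim.const_mul_atTop (div_pos (hb_pos 1 le_rfl) (ha_pos 1 le_rfl)))
    filter_upwards [eventually_ge_atTop 1] with n hn
    have h1 := hba (Set.mem_Ici.2 le_rfl) (Set.mem_Ici.2 hn) hn
    rwa [le_div_iff₀ (ha_pos n hn)] at h1
  have Ha : TailImpliesWeakLaw B a := tailImpliesWeakLaw_of_iidSeq ha_pos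
    fun Ω _ P _ X hX hs => (hsymm Ω P X hX hs).2
  intro Ω _ P _ X hX
  have hXm := hX.measurable 0
  have : IsProbabilityMeasure (P.map (X 0)) := Measure.isProbabilityMeasure_map hXm.aemeasurable
  have hlaw : ∀ (n : ℕ) (t : ℝ), P {ω | t < ‖partialSum X n ω -
      truncatedCentering P (X 0) n (b n)‖} =
      convPow (P.map (X 0)) n {x | t < ‖x - truncatedMean (P.map (X 0)) n (b n)‖} := by
    intro n t
    rw [← map_partialSum_eq_convPow hX, Measure.map_apply (measurable_partialSum hX n)
      (measurableSet_norm_sub_gt _ _), truncatedCentering_eq P hXm]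
    rfl
  simp only [← normTail_map P hXm]
  constructor
  · intro hT
    rw [tendstoInMeasure_iff_norm]
    intro ε hε
    have Hb := Ha.of_monotoneOn_div ha_pos hb_pos ha_mono hb_lim hba
    -- Half of `ε` absorbs the passage from the non-strict inequality of convergence in measure to a
    -- strict one.
    refine tendsto_zero_of_le (Hb.tendsto_centered hb_pos _ hT (half_pos hε)) ?_
    filter_upwards [eventually_ge_atTop 1] with n hn
    have hb := hb_pos n hn
    rw [← hlaw]
    refine measure_mono fun ω hω => ?_
    have hω' : ε ≤ ‖(b n)⁻¹ • (partialSum X n ω - truncatedCentering P (X 0) n (b n)) - 0‖ := hω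
    rw [sub_zero, norm_smul, norm_inv, Real.norm_of_nonneg hb.le, inv_mul_eq_div,
      le_div_iff₀ hb] at hω'
    change ε / 2 * b n < ‖partialSum X n ω - truncatedCentering P (X 0) n (b n)‖
    have : 0 < ε * b n := by positivity
    linarith
  · intro hpos lam hlam
    by_contra hzero
    have h0 := le_antisymm (not_lt.1 hzero) zero_le
    have hP : Tendsto (fun n : ℕ => P {ω | lam < ‖partialSum X n ω -
        truncatedCentering P (X 0) n (b n)‖ / b n}) atTop (𝓝 0) :=
      tendsto_of_le_liminf_of_limsup_le zero_le h0.le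
    have hb' : ∀ n, 1 ≤ n → 0 < 2 * (lam * b n) := fun n hn => by
      have := hb_pos n hn; positivity
    -- The transfer is applied to $2\lambda b_n$, the level reached by the symmetrized sums; a
    -- constant factor does not affect monotonicity of the ratio.
    have Hb := Ha.of_monotoneOn_div (b := fun n => 2 * (lam * b n)) ha_pos hb' ha_mono
      ((hb_lim.const_mul_atTop hlam).const_mul_atTop two_pos) (by
        intro i hi j hj hij
        have := hba hi hj hij
        simp only [← mul_assoc, mul_div_assoc] at this ⊢
        exact mul_le_mul_of_nonneg_left this (by positivity))
    have hT := Hb.tendsto_mul_normTail_of_centered hlam hb_lim (P.map (X 0))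
      (fun n => truncatedMean (P.map (X 0)) n (b n)) (by
        refine tendsto_zero_of_le hP ?_
        filter_upwards [eventually_ge_atTop 1] with n hn
        rw [← hlaw]
        refine measure_mono fun ω hω => ?_
        exact (lt_div_iff₀ (hb_pos n hn)).2 hω)
    rw [hT.limsup_eq] at hpos
    exact lt_irrefl _ hpos
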